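/- Let $F$ be a field of characteristic $2$. An $F$-quaternion algebra is a central simple $F$-algebra of dimension $4$ over $F$. Suppose that $F$ is a Kaplansky field, that is, up to isomorphism of $F$-algebras there is exactly one $F$-quaternion division algebra, and let $Q$ be such an algebra. An $F$-involution on $Q$ is an $F$-linear map $\theta\colon Q\to Q$ with $\theta(xy)=\theta(y)\theta(x)$ for all $x,y\in Q$ and $\theta^2=\mathrm{id}_Q$. A hermitian form over $(Q,\theta)$ is a pair $(V,h)$ of a finite-dimensional right $Q$-vector space $V$ and a bi-additive map $h\colon V\times V\to Q$ such that $h(xd_1,yd_2)=\theta(d_1)h(x,y)d_2$ and $h(y,x)=\theta(h(x,y))$ for all $x,y\in V$, $d_1,d_2\in Q$; it is anisotropic if $h(x,x)\neq 0$ for all $x\in V\setminus\{0\}$. Let $$u^+(Q)=\sup\{\dim_Q V \mid (V,h)\text{ is an anisotropic hermitian form over }(Q,\theta)\}\in\mathbb{N}\cup\{\infty\}.$$ Let $F^2=\{x^2\mid x\in F\}$ and let $[F:F^2]\in\mathbb{N}\cup\{\infty\}$ be the degree of $F$ over its subfield $F^2$. Then $Q$ has an $F$-involution, and for every $F$-involution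 $\theta$ on $Q$ one has $$u^+(Q)=\tfrac12[F:F^2]+1,$$ where both sides may be infinite. In particular $u^+(Q)$ does not depend on $\theta$. -/

import Mathlib

universe u v w

/-- An `F`-quaternion algebra: a central simple `F`-algebra of degree `2`, that is, of
dimension `4 = 2 ^ 2` over `F`. -/
structure IsQuaternionAlgebra (F : Type u) (A : Type v) [Field F] [Ring A] [Algebra F A] :
    Prop where
  isCentral : Algebra.IsCentral F A
  isSimpleRing : IsSimpleRing A
  finrank_eq : Module.finrank F A = 4

/-- A Kaplansky field: there is a unique `F`-quaternion division algebra up to isomorphism of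
`F`-algebras. (Every `F`-quaternion algebra is in bijection with `Fin 4 → F`, so it is no
restriction to consider algebras living in the universe of `F`.) -/
def IsKaplanskyField (F : Type u) [Field F] : Prop :=
  ∃ (Q : Type u) (_ : DivisionRing Q) (_ : Algebra F Q), IsQuaternionAlgebra F Q ∧
    ∀ (Q' : Type u) [DivisionRing Q'] [Algebra F Q'], IsQuaternionAlgebra F Q' →
      Nonempty (Q' ≃ₐ[F] Q)

/-- An `F`-involution on the `F`-algebra `A`: an `F`-linear anti-multiplicative map of `A` to
itself whose square is the identity. -/
structure FInvolution (F : Type u) (A : Type v) [Field F] [Ring A] [Algebra F A]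
    extends A →ₗ[F] A where
  map_mul' : ∀ x y : A, toFun (x * y) = toFun y * toFun x
  involutive' : ∀ x : A, toFun (toFun x) = x

instance (F : Type u) (A : Type v) [Field F] [Ring A] [Algebra F A] :
    CoeFun (FInvolution F A) (fun _ => A → A) :=
  ⟨fun θ => θ.toLinearMap⟩

/-- A hermitian form over `(D, θ)` on the right `D`-vector space `V`; the scalar product `x d` of
the right vector space is written `MulOpposite.op d • x`. -/
structure HermitianForm {F : Type u} {D : Type v} [Field F] [DivisionRing D] [Algebra F D]
    (θ : FInvolution F D) (V : Type w) [AddCommGroup V] [Module Dᵐᵒᵖ V] where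
  /-- the underlying bi-additive map -/
  form : V →+ V →+ D
  form_smul : ∀ (x y : V) (d₁ d₂ : D),
    form (MulOpposite.op d₁ • x) (MulOpposite.op d₂ • y) = θ d₁ * form x y * d₂
  form_swap : ∀ x y : V, form y x = θ (form x y)

/-- A hermitian form is anisotropic if `h(x, x) ≠ 0` for all nonzero `x`. -/
def HermitianForm.Anisotropic {F : Type u} {D : Type v} [Field F] [DivisionRing D] [Algebra F D]
    {θ : FInvolution F D} {V : Type w} [AddCommGroup V] [Module Dᵐᵒᵖ V]
    (h : HermitianForm θ V) : Prop :=
  ∀ x : V, x ≠ 0 → h.form x x ≠ 0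

/-- The invariant `u⁺(D)`, computed with the `F`-involution `θ` on the division algebra `D`: the
supremum, possibly infinite, of the dimensions of the anisotropic hermitian forms over `(D, θ)`
on finite-dimensional right `D`-vector spaces. (Such a space is isomorphic to some `Dⁿ`, so it is
no restriction to consider spaces living in the universe of `D`.) -/
noncomputable def uPlus {F : Type u} {D : Type v} [Field F] [DivisionRing D] [Algebra F D]
    (θ : FInvolution F D) : ℕ∞ :=
  sSup {n : ℕ∞ | ∃ (V : Type v) (_ : AddCommGroup V) (_ : Module Dᵐᵒᵖ V)
    (_ : Module.Finite Dᵐᵒᵖ V) (h : HermitianForm θ V),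
      h.Anisotropic ∧ n = (Module.finrank Dᵐᵒᵖ V : ℕ∞)}

/-- The degree `[F : F²]`, possibly infinite, of a field `F` of characteristic `2` over its
subfield `F²` of squares (the image of the Frobenius `x ↦ x ^ 2`). -/
noncomputable def degreeOverSquares (F : Type u) [Field F] [CharP F 2] : ℕ∞ :=
  Cardinal.toENat (Module.rank (frobenius F 2).fieldRange F)

/-! Write `Q` as generated by `i`, `j` with `i² = i + a`, `j² = b`, `ji = (i + 1)j`, and let `γ` be
its canonical involution. Every `F`-involution is `γ` conjugated by a symmetric unit, and scaling
forms by that unit preserves anisotropy, so `θ = γ` suffices (`uPlus_eq_uPlus_canonical`).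

Upper bound: `z + γ z` is always a scalar, so `x ↦ h(x,x)` is additive modulo `F`, with values in
`Sym/F ≅ F × F`, and its kernel is a `Q`-subspace. On a complement of the kernel the map is
injective and Frobenius-semilinear, which bounds the dimension there by `[F:F²]/2`. The kernel
itself has dimension at most `1`, because the Kaplansky hypothesis makes the reduced norm surjective
(`IsKaplanskyField.exists_reducedNorm_eq`).

Lower bound: if `l₁, …, lₙ` are independent over `F²(b)`, then `⟨1, l₁j, …, lₙj⟩` is anisotropic,
and `[F:F²] ≤ 2[F:F²(b)]`. -/

open Quaternion

/-! ### Quaternion division algebras in characteristic `2`: generators and relations -/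

section Structure

variable {F : Type u} [Field F] {Q : Type v} [DivisionRing Q] [Algebra F Q]

theorem IsQuaternionAlgebra.mem_range_of_commute (hQ : IsQuaternionAlgebra F Q) {x : Q}
    (hx : ∀ y, y * x = x * y) : ∃ c : F, algebraMap F Q c = x := by
  have := hQ.isCentral.out (Subalgebra.mem_center_iff.2 hx)
  exact Algebra.mem_bot.1 this

theorem IsQuaternionAlgebra.finite (hQ : IsQuaternionAlgebra F Q) : Module.Finite F Q :=
  Module.finite_of_finrank_pos (by rw [hQ.finrank_eq]; norm_num)

/-- Every element of a quaternion division algebra is quadratic over the base field. -/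
theorem IsQuaternionAlgebra.exists_sq_eq (hQ : IsQuaternionAlgebra F Q) (x : Q) :
    ∃ t s : F, x * x = algebraMap F Q t * x + algebraMap F Q s := by
  have := hQ.finite
  by_cases hx : ∀ y, y * x = x * y
  · obtain ⟨c, rfl⟩ := hQ.mem_range_of_commute hx
    exact ⟨c, 0, by simp⟩
  push Not at hx
  obtain ⟨y, hy⟩ := hx
  let f : (Fin 3 → F) →ₗ[F] Q := Fintype.linearCombination F ![1, x, x * x]
  have hf (p) : f p = algebraMap F Q (p 0) + algebraMap F Q (p 1) * x
      + algebraMap F Q (p 2) * (x * x) := by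
    simp [f, Fintype.linearCombination_apply, Fin.sum_univ_three, Algebra.smul_def]
  have hcomm (p) : Commute (f p) x := by
    rw [hf]
    have h1 (c : F) : Commute (algebraMap F Q c) x := Algebra.commutes c x
    have h2 : Commute x x := Commute.refl x
    exact ((h1 _).add_left ((h1 _).mul_left h2)).add_left ((h1 _).mul_left (h2.mul_left h2))
  -- If `1, x, x²` were independent with span `V`, then `V ⊕ Vy` would embed in `Q`, giving `6 ≤ 4`:
  -- a relation `p + p'y = 0` with `p' ≠ 0` would make `y` commute with `x`.
  have key : ∃ p : Fin 3 → F, p ≠ 0 ∧ f p = 0 := by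
    by_contra! hcon
    let g : (Fin 3 → F) × (Fin 3 → F) →ₗ[F] Q :=
      f.coprod ((LinearMap.mulRight F y).comp f)
    have hg : Function.Injective g := by
      rw [injective_iff_map_eq_zero]
      rintro ⟨p, p'⟩ h
      have h : f p + f p' * y = 0 := by simpa [g] using h
      have hp' : p' = 0 := by
        by_contra hne
        have h0 := hcon p' hne
        have h1 : y = -((f p')⁻¹ * f p) := by
          rw [add_eq_zero_iff_eq_neg'] at h
          rw [← mul_neg, ← h, inv_mul_cancel_left₀ h0]
        apply hy
        rw [h1]
        exact (((hcomm p').inv_left₀).mul_left (hcomm p)).neg_left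
      subst hp'
      have hp : p = 0 := by
        by_contra hne
        exact hcon p hne (by simpa using h)
      simp [hp]
    have := LinearMap.finrank_le_finrank_of_injective hg
    rw [hQ.finrank_eq] at this
    simp at this
  obtain ⟨p, hp, h⟩ := key
  rw [hf] at h
  have hinj := (algebraMap F Q).injective
  by_cases h2 : p 2 = 0
  · by_cases h1 : p 1 = 0
    · have h0 : p 0 = 0 := hinj (by simpa [h1, h2] using h)
      refine absurd ?_ hp
      ext i; fin_cases i <;> simp [h0, h1, h2]
    · exfalso
      apply hy
      have hz : algebraMap F Q (p 1) ≠ 0 := by simpa using h1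
      have : x = algebraMap F Q (-(p 1)⁻¹ * p 0) := by
        apply mul_left_cancel₀ hz
        rw [← map_mul]
        have h : algebraMap F Q (p 0) + algebraMap F Q (p 1) * x = 0 := by simpa [h2] using h
        rw [eq_neg_of_add_eq_zero_right h, ← map_neg]
        congr 1
        field_simp
      rw [this, Algebra.commutes]
  · refine ⟨-(p 2)⁻¹ * p 1, -(p 2)⁻¹ * p 0, ?_⟩
    have hz : algebraMap F Q (p 2) ≠ 0 := by simpa using h2
    apply mul_left_cancel₀ hz
    rw [mul_add, ← mul_assoc _ (algebraMap F Q _) x, ← map_mul, ← map_mul, eq_neg_of_add_eq_zero_right h]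
    have e1 : p 2 * (-(p 2)⁻¹ * p 1) = - p 1 := by field_simp
    have e2 : p 2 * (-(p 2)⁻¹ * p 0) = - p 0 := by field_simp
    rw [e1, e2, map_neg, map_neg]
    noncomm_ring

variable [CharP F 2]

/-- A noncentral element of nonzero trace `t` becomes `i` after division by `t`. If there were none,
all squares would be scalars, hence so would all `zw + wz`; then `x(xy + yx) = x(xy) + (xy)x` forces
`x` to be central. -/
theorem IsQuaternionAlgebra.exists_artinSchreier (hQ : IsQuaternionAlgebra F Q) :
    ∃ (a : F) (i : Q), i * i = algebraMap F Q a + i ∧ ∃ y, y * i ≠ i * y := by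
  have : CharP Q 2 := charP_of_injective_algebraMap (algebraMap F Q).injective 2
  have hex : ∃ (t s : F) (x : Q), t ≠ 0 ∧ x * x = algebraMap F Q t * x + algebraMap F Q s ∧
      ∃ y, y * x ≠ x * y := by
    by_contra! hcon
    have hcen (x y : Q) : y * x = x * y := by
      by_contra hne
      have hsq (z : Q) : ∃ s : F, z * z = algebraMap F Q s := by
        obtain ⟨t, s, h⟩ := hQ.exists_sq_eq z
        by_cases ht : t = 0
        · exact ⟨s, by simpa [ht] using h⟩
        · have hc := hcon t s z ht h
          obtain ⟨c, rfl⟩ := hQ.mem_range_of_commute hc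
          exact ⟨c * c, by simp⟩
      have hpol (z w : Q) : ∃ s : F, z * w + w * z = algebraMap F Q s := by
        obtain ⟨s1, h1⟩ := hsq z
        obtain ⟨s2, h2⟩ := hsq w
        obtain ⟨s3, h3⟩ := hsq (z + w)
        refine ⟨s3 - s1 - s2, ?_⟩
        rw [map_sub, map_sub, ← h1, ← h2, ← h3]
        noncomm_ring
      obtain ⟨c, hc⟩ := hpol x y
      obtain ⟨d, hd⟩ := hpol x (x * y)
      have hxc : x * algebraMap F Q c = algebraMap F Q d := by
        rw [← hc, ← hd]; noncomm_ring
      have hc0 : algebraMap F Q c ≠ 0 := by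
        intro h0
        rw [h0] at hc
        exact hne (CharTwo.add_eq_zero.1 hc).symm
      have : x = algebraMap F Q d * (algebraMap F Q c)⁻¹ := by
        rw [← hxc, mul_inv_cancel_right₀ hc0]
      rw [← map_inv₀, ← map_mul] at this
      exact hne (by rw [this, Algebra.commutes])
    have htop : (⊥ : Subalgebra F Q) = ⊤ := by
      rw [eq_top_iff]
      intro x _
      exact Algebra.mem_bot.2 (hQ.mem_range_of_commute (hcen x))
    have h4 := hQ.finrank_eq
    have h1 := Subalgebra.bot_eq_top_iff_finrank_eq_one.1 htop
    omega
  obtain ⟨t, s, x, ht, hx, y, hy⟩ := hex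
  have ht' : algebraMap F Q t ≠ 0 := by simpa using ht
  refine ⟨t⁻¹ * t⁻¹ * s, algebraMap F Q t⁻¹ * x, ?_, y, ?_⟩
  · have h1 : algebraMap F Q t⁻¹ * x * (algebraMap F Q t⁻¹ * x)
        = algebraMap F Q (t⁻¹ * t⁻¹) * (x * x) := by
      rw [mul_assoc, ← mul_assoc x, ← Algebra.commutes, map_mul]
      noncomm_ring
    rw [h1, hx, mul_add, ← mul_assoc, ← map_mul, ← map_mul, add_comm]
    congr 3
    field_simp
  · intro h
    apply hy
    rw [← mul_assoc, ← Algebra.commutes, mul_assoc, mul_assoc] at h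
    exact mul_left_cancel₀ (by simpa using ht) h

/-- A quaternion division algebra in characteristic `2` has a presentation
`i ^ 2 = a + i`, `j ^ 2 = b`, `j * i = (i + 1) * j`. -/
theorem IsQuaternionAlgebra.exists_algEquiv (hQ : IsQuaternionAlgebra F Q) :
    ∃ a b : F, Nonempty (ℍ[F,a,1,b] ≃ₐ[F] Q) := by
  have : CharP Q 2 := charP_of_injective_algebraMap (algebraMap F Q).injective 2
  have := hQ.finite
  obtain ⟨a, i, hi, y, hy⟩ := hQ.exists_artinSchreier
  -- In characteristic `2`, bracketing twice with `i` is bracketing with `i² = i + a`, so the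
  -- commutator `j` satisfies `ij + ji = j`.
  let j := i * y + y * i
  have hj0 : j ≠ 0 := fun h => hy (CharTwo.add_eq_zero.1 h).symm
  have hac : algebraMap F Q a * y = y * algebraMap F Q a := Algebra.commutes a y
  have hij : i * j + j * i = j := by
    have : i * j + j * i = (i * i) * y + y * (i * i) + (i * y * i + i * y * i) := by
      simp only [j]; noncomm_ring
    rw [this, CharTwo.add_self_eq_zero, hi, add_mul, mul_add, hac]
    have : y * algebraMap F Q a + i * y + (y * algebraMap F Q a + y * i) + 0
      = (y * algebraMap F Q a + y * algebraMap F Q a) + (i * y + y * i) := by abel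
    rw [this, CharTwo.add_self_eq_zero, zero_add]
  have hji : j * i = j - i * j := eq_sub_of_add_eq' hij
  obtain ⟨t, b, hjj⟩ := hQ.exists_sq_eq j
  -- Bracketing `j² = tj + b` with `i` gives `tj` on the right, but `2j² = 0` on the left.
  have ht : t = 0 := by
    have h1 : i * (j * j) + (j * j) * i = algebraMap F Q t * j := by
      rw [hjj, mul_add, add_mul, ← Algebra.commutes b, ← mul_assoc i, ← Algebra.commutes t i,
        mul_assoc, mul_assoc]
      have : algebraMap F Q t * (i * j) + algebraMap F Q b * i
          + (algebraMap F Q t * (j * i) + algebraMap F Q b * i)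
          = algebraMap F Q t * (i * j + j * i) + (algebraMap F Q b * i + algebraMap F Q b * i) := by
        noncomm_ring
      rw [this, hij, CharTwo.add_self_eq_zero, add_zero]
    have h2 : i * (j * j) + (j * j) * i = 0 := by
      have : i * (j * j) + (j * j) * i = (i * j + j * i) * j + j * (i * j + j * i)
          - (j * i * j + j * i * j) := by noncomm_ring
      rw [this, hij, CharTwo.add_self_eq_zero, CharTwo.add_self_eq_zero, sub_zero]
    rw [h2] at h1
    have := (mul_eq_zero.1 h1.symm).resolve_right hj0
    simpa using this
  subst ht
  let B : QuaternionAlgebra.Basis Q a 1 b :=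
    { i := i, j := j, k := i * j
      i_mul_i := by rw [hi, one_smul, Algebra.algebraMap_eq_smul_one]
      j_mul_j := by rw [hjj, Algebra.algebraMap_eq_smul_one b]; simp
      i_mul_j := rfl
      j_mul_i := by rw [one_smul, hji] }
  have hF (c d : F) (h : algebraMap F Q c + algebraMap F Q d * i = 0) : c = 0 ∧ d = 0 := by
    have hd : d = 0 := by
      by_contra hd
      have hz : algebraMap F Q d ≠ 0 := by simpa using hd
      have : i = algebraMap F Q (-d⁻¹ * c) := by
        apply mul_left_cancel₀ hz
        rw [← map_mul, eq_neg_of_add_eq_zero_right h, ← map_neg]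
        congr 1
        field_simp
      exact hy (by rw [this, Algebra.commutes])
    subst hd
    exact ⟨by simpa using h, rfl⟩
  have hinj : Function.Injective B.liftHom := by
    rw [injective_iff_map_eq_zero]
    intro x hx
    have hx : (algebraMap F Q x.re + algebraMap F Q x.imI * i)
        + (algebraMap F Q x.imJ + algebraMap F Q x.imK * i) * j = 0 := by
      rw [← hx]
      simp [B, QuaternionAlgebra.Basis.lift, Algebra.smul_def]
      noncomm_ring
    set u := algebraMap F Q x.re + algebraMap F Q x.imI * i with hu
    set w := algebraMap F Q x.imJ + algebraMap F Q x.imK * i with hw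
    have hc (c d : F) : Commute i (algebraMap F Q c + algebraMap F Q d * i) :=
      (show Commute i _ from (Algebra.commutes c i).symm).add_right
        ((show Commute i _ from (Algebra.commutes d i).symm).mul_right (Commute.refl i))
    -- Bracketing with `i` kills `u` and fixes `wj`, so it separates the two summands.
    have h3 : w * j = 0 := by
      have e1 : i * u = u * i := hc _ _
      have e2 : i * w = w * i := hc _ _
      have : i * (u + w * j) + (u + w * j) * i
          = (i * u + u * i) + ((i * w) * j + w * (j * i)) := by noncomm_ring
      rw [hx, e1, e2, CharTwo.add_self_eq_zero, mul_assoc, ← mul_add, hij] at this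
      simpa using this.symm
    have hw0 : w = 0 := (mul_eq_zero.1 h3).resolve_right hj0
    rw [hw0, zero_mul, add_zero] at hx
    obtain ⟨h0, h1⟩ := hF _ _ hx
    obtain ⟨h2, h3⟩ := hF _ _ hw0
    ext <;> assumption
  have hbij : Function.Bijective B.liftHom := by
    refine ⟨hinj, ?_⟩
    have hfr : Module.finrank F ℍ[F,a,1,b] = Module.finrank F Q := by
      rw [hQ.finrank_eq, QuaternionAlgebra.finrank_eq_four]
    exact (LinearMap.injective_iff_surjective_of_finrank_eq_finrank
      (f := B.liftHom.toLinearMap) hfr).1 hinj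
  exact ⟨a, b, ⟨AlgEquiv.ofBijective B.liftHom hbij⟩⟩

end Structure

/-! ### Skolem–Noether and independence of the involution -/

section Canonical

variable {F : Type u} [Field F] {Q : Type v} [DivisionRing Q] [Algebra F Q] {a b : F}

namespace FInvolution

theorem map_mul {A : Type v} [Ring A] [Algebra F A] (θ : FInvolution F A) (x y : A) :
    θ (x * y) = θ y * θ x := θ.map_mul' x y

theorem apply_apply {A : Type v} [Ring A] [Algebra F A] (θ : FInvolution F A) (x : A) :
    θ (θ x) = x := θ.involutive' x

theorem map_one {A : Type v} [Ring A] [Algebra F A] (θ : FInvolution F A) : θ 1 = 1 := by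
  have h := θ.map_mul (θ 1) 1
  rw [mul_one, θ.apply_apply, mul_one] at h
  exact h.symm

theorem map_algebraMap {A : Type v} [Ring A] [Algebra F A] (θ : FInvolution F A) (c : F) :
    θ (algebraMap F A c) = algebraMap F A c := by
  rw [Algebra.algebraMap_eq_smul_one, map_smul, θ.map_one]

theorem map_ne_zero (θ : FInvolution F Q) {x : Q} (hx : x ≠ 0) : θ x ≠ 0 := by
  intro h
  apply hx
  rw [← θ.apply_apply x, h, map_zero]

theorem map_inv (θ : FInvolution F Q) (x : Q) : θ x⁻¹ = (θ x)⁻¹ := by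
  by_cases hx : x = 0
  · simp [hx]
  · apply eq_inv_of_mul_eq_one_left
    rw [← θ.map_mul, mul_inv_cancel₀ hx, θ.map_one]

/-- The canonical involution, transported along a presentation as a quaternion algebra. -/
def canonical {A : Type v} [Ring A] [Algebra F A] (e : ℍ[F,a,1,b] ≃ₐ[F] A) :
    FInvolution F A where
  toFun x := e (star (e.symm x))
  map_add' x y := by simp
  map_smul' c x := by
    have : star (c • e.symm x) = c • star (e.symm x) := by
      ext <;> simp
    rw [map_smul, this, map_smul, RingHom.id_apply]
  map_mul' x y := by simp
  involutive' x := by simp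

theorem canonical_apply {A : Type v} [Ring A] [Algebra F A] (e : ℍ[F,a,1,b] ≃ₐ[F] A)
    (x : ℍ[F,a,1,b]) : canonical e (e x) = e (star x) :=
  show e (star (e.symm (e x))) = _ by rw [e.symm_apply_apply]

end FInvolution

/-- The reduced norm, computed in a presentation as a quaternion algebra. -/
def reducedNorm {A : Type v} [Ring A] [Algebra F A] (e : ℍ[F,a,1,b] ≃ₐ[F] A) (x : A) : F :=
  (star (e.symm x) * e.symm x).re

theorem canonical_mul_self {A : Type v} [Ring A] [Algebra F A] (e : ℍ[F,a,1,b] ≃ₐ[F] A) (x : A) :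
    FInvolution.canonical e x * x = algebraMap F A (reducedNorm e x) := by
  obtain ⟨x, rfl⟩ := e.surjective x
  rw [FInvolution.canonical_apply, ← map_mul, QuaternionAlgebra.star_mul_eq_coe, reducedNorm,
    e.symm_apply_apply, ← e.commutes, QuaternionAlgebra.coe_algebraMap]

/-- Skolem–Noether by explicit elements: `y` carries `i` to `φ i`, then `z`, commuting with `i`,
corrects the image of `j`. -/
theorem exists_intertwining [CharP F 2] (e : ℍ[F,a,1,b] ≃ₐ[F] Q) (φ : Q →ₐ[F] Q) :
    ∃ u : Q, u ≠ 0 ∧ ∀ x, φ x * u = u * x := by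
  have : CharP Q 2 := charP_of_injective_algebraMap (algebraMap F Q).injective 2
  let B := (QuaternionAlgebra.Basis.self F : QuaternionAlgebra.Basis ℍ[F,a,1,b] a 1 b).compHom
    e.toAlgHom
  set i := B.i with hi
  set j := B.j with hj
  have hii : i * i = algebraMap F Q a + i := by
    rw [hi, B.i_mul_i, one_smul, Algebra.algebraMap_eq_smul_one]
  have hjj : j * j = algebraMap F Q b := by
    rw [hj, B.j_mul_j, Algebra.algebraMap_eq_smul_one]
  have hji : j * i = (i + 1) * j := by
    rw [hi, hj, B.j_mul_i, one_smul, ← B.i_mul_j, CharTwo.sub_eq_add]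
    noncomm_ring
  have hspan (x : Q) : ∃ c₀ c₁ c₂ c₃ : F, x = algebraMap F Q c₀ + algebraMap F Q c₁ * i
      + algebraMap F Q c₂ * j + algebraMap F Q c₃ * (i * j) := by
    obtain ⟨x, rfl⟩ := e.surjective x
    refine ⟨x.re, x.imI, x.imJ, x.imK, ?_⟩
    have : QuaternionAlgebra.Basis.liftHom B x = e x := by
      have : QuaternionAlgebra.Basis.liftHom B = e.toAlgHom :=
        QuaternionAlgebra.lift.apply_symm_apply e.toAlgHom
      rw [this]; rfl
    rw [← this]
    simp [QuaternionAlgebra.Basis.lift, Algebra.smul_def, hi, hj]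
  have hj0 : j ≠ 0 := by
    intro h
    have : (⟨0, 0, 1, 0⟩ : ℍ[F,a,1,b]) = 0 := e.injective (by simpa [hj, B] using h)
    simpa using congrArg QuaternionAlgebra.imJ this
  have hi' : φ i * φ i = algebraMap F Q a + φ i := by rw [← map_mul, hii, map_add, φ.commutes]
  have hjj' : φ j * φ j = algebraMap F Q b := by rw [← map_mul, hjj, φ.commutes]
  have hji' : φ j * φ i = (φ i + 1) * φ j := by
    rw [← map_mul, hji, map_mul, map_add, map_one]
  -- Both `i` and `φ i` are roots of `X² + X + a`, so `φ i + i + 1` intertwines them. It vanishes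
  -- only if `φ i = i + 1`, and then `j` does.
  obtain ⟨y, hy0, hy⟩ : ∃ y : Q, y ≠ 0 ∧ φ i * y = y * i := by
    by_cases h : φ i + i + 1 = 0
    · have h : φ i = i + 1 := by
        rw [add_assoc] at h; exact CharTwo.add_eq_zero.1 h
      exact ⟨j, hj0, by rw [h, hji]⟩
    · refine ⟨_, h, ?_⟩
      have e1 : φ i * (φ i + i + 1) = φ i * φ i + φ i + φ i * i := by noncomm_ring
      have e2 : (φ i + i + 1) * i = i * i + i + φ i * i := by noncomm_ring
      rw [e1, e2, hii, hi', add_assoc (algebraMap F Q a) (φ i), add_assoc (algebraMap F Q a) i,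
        CharTwo.add_self_eq_zero, CharTwo.add_self_eq_zero]
  set j' := y⁻¹ * φ j * y with hj'
  have hyj' : φ j * y = y * j' := by rw [hj', mul_assoc, mul_inv_cancel_left₀ hy0]
  have h1 : j' * j' = algebraMap F Q b := by
    apply mul_left_cancel₀ hy0
    rw [← mul_assoc, ← hyj', mul_assoc, ← hyj', ← mul_assoc, hjj', Algebra.commutes]
  have h2 : j' * i = (i + 1) * j' := by
    apply mul_left_cancel₀ hy0
    have : y * ((i + 1) * j') = (y * i + y) * j' := by noncomm_ring
    rw [← mul_assoc, ← hyj', mul_assoc, ← hy, this, ← hy, ← mul_assoc, hji']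
    have : (φ i * y + y) * j' = (φ i + 1) * (y * j') := by noncomm_ring
    rw [this, ← hyj', mul_assoc]
  -- Both `j'` and `j` square to `b` and act alike on `i`, so `1 + j'j⁻¹` commutes with `i` and
  -- intertwines them. It vanishes only if `j' = j`.
  obtain ⟨z, hz0, hzi, hzj⟩ : ∃ z : Q, z ≠ 0 ∧ i * z = z * i ∧ j' * z = z * j := by
    by_cases h : 1 + j' * j⁻¹ = 0
    · have : j' = j := by
        have h3 := CharTwo.add_eq_zero.1 h
        rw [← one_mul j, h3, inv_mul_cancel_right₀ hj0]
      exact ⟨1, one_ne_zero, by simp, by simp [this]⟩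
    · refine ⟨_, h, ?_, ?_⟩
      · have h3 : j⁻¹ * (i + 1) = i * j⁻¹ := by
          apply mul_right_cancel₀ hj0
          rw [mul_assoc, ← hji, inv_mul_cancel_left₀ hj0, inv_mul_cancel_right₀ hj0]
        have h4 : j⁻¹ * i = (i + 1) * j⁻¹ := by
          rw [add_mul, one_mul, ← h3, mul_add, mul_one, add_assoc, CharTwo.add_self_eq_zero,
            add_zero]
        have h5 : (i + 1) * j' * j⁻¹ + j' * j⁻¹ = j' * ((i + 1) * j⁻¹) := by
          rw [← h2]; noncomm_ring
        have h6 : i * (j' * j⁻¹) = (i + 1) * j' * j⁻¹ + j' * j⁻¹ - (j' * j⁻¹ + j' * j⁻¹) := by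
          noncomm_ring
        rw [mul_add, add_mul, h6, CharTwo.add_self_eq_zero, h5, ← h4]
        noncomm_ring
      · have h3 : algebraMap F Q b * j⁻¹ = j := by rw [← hjj, mul_inv_cancel_right₀ hj0]
        rw [mul_add, add_mul, ← mul_assoc, h1, h3, inv_mul_cancel_right₀ hj0]
        noncomm_ring
  have hui : φ i * (y * z) = y * z * i := by rw [← mul_assoc, hy, mul_assoc, hzi, mul_assoc]
  have huj : φ j * (y * z) = y * z * j := by rw [← mul_assoc, hyj', mul_assoc, hzj, mul_assoc]
  refine ⟨y * z, mul_ne_zero hy0 hz0, fun x => ?_⟩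
  have hmul {p q : Q} (hp : φ p * (y * z) = y * z * p) (hq : φ q * (y * z) = y * z * q) :
      φ (p * q) * (y * z) = y * z * (p * q) := by
    rw [map_mul, mul_assoc, hq, ← mul_assoc, hp, mul_assoc]
  have hadd {p q : Q} (hp : φ p * (y * z) = y * z * p) (hq : φ q * (y * z) = y * z * q) :
      φ (p + q) * (y * z) = y * z * (p + q) := by
    rw [map_add, add_mul, hp, hq, mul_add]
  have halg (c : F) : φ (algebraMap F Q c) * (y * z) = y * z * algebraMap F Q c := by
    rw [φ.commutes, Algebra.commutes]
  obtain ⟨c₀, c₁, c₂, c₃, rfl⟩ := hspan x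
  exact hadd (hadd (hadd (halg _) (hmul (halg _) hui)) (hmul (halg _) huj))
    (hmul (halg _) (hmul hui huj))

/-- Every involution of the first kind is the canonical involution followed by conjugation with a
symmetric element. -/
theorem FInvolution.exists_eq_conj_canonical [CharP F 2] (hQ : IsQuaternionAlgebra F Q)
    (e : ℍ[F,a,1,b] ≃ₐ[F] Q) (θ : FInvolution F Q) :
    ∃ u : Q, u ≠ 0 ∧ canonical e u = u ∧ ∀ x, θ x * u = u * canonical e x := by
  set γ := canonical e
  let φ : Q →ₐ[F] Q := AlgHom.ofLinearMap (θ.toLinearMap.comp γ.toLinearMap)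
    (by simp [γ.map_one, θ.map_one]) (by intro x y; simp [γ.map_mul, θ.map_mul])
  have hφ (x : Q) : φ x = θ (γ x) := rfl
  obtain ⟨u, hu0, hu⟩ := exists_intertwining e φ
  have hu' (x : Q) : θ x * u = u * γ x := by
    rw [← hu, hφ, γ.apply_apply]
  have hγu0 := γ.map_ne_zero hu0
  have h1 (x : Q) : x * (u * (γ u)⁻¹) = (u * (γ u)⁻¹) * x := by
    have h2 : θ x = u * γ x * u⁻¹ := by
      rw [← hu', mul_inv_cancel_right₀ hu0]
    have h3 := hu' (θ x)
    -- Expanding `θ² = id` shows that `u γ(u)⁻¹` is central; applying `γ` again makes its square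
    -- `1`, hence in characteristic `2` it is `1`.
    rw [θ.apply_apply, h2, γ.map_mul, γ.map_mul, γ.apply_apply, γ.map_inv] at h3
    have h4 : x * u = (u * (γ u)⁻¹ * x) * γ u := by rw [h3]; noncomm_ring
    rw [← mul_assoc, h4, mul_inv_cancel_right₀ hγu0]
  obtain ⟨c, hc⟩ := hQ.mem_range_of_commute h1
  have h2 : algebraMap F Q c * γ u = u := by rw [hc, inv_mul_cancel_right₀ hγu0]
  have h3 : algebraMap F Q c * u = γ u := by
    conv_rhs => rw [← h2, γ.map_mul, γ.apply_apply, γ.map_algebraMap]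
    exact Algebra.commutes c u
  have hc1 : c = 1 := by
    have h4 : algebraMap F Q (c * c) * u = algebraMap F Q 1 * u := by
      rw [RingHom.map_mul, mul_assoc, h3, h2, RingHom.map_one, one_mul]
    have h5 : c * c = 1 := (algebraMap F Q).injective (mul_right_cancel₀ hu0 h4)
    rcases mul_self_eq_one_iff.1 h5 with h | h
    · exact h
    · rw [h, CharTwo.neg_eq]
  refine ⟨u, hu0, ?_, hu'⟩
  rw [← h3, hc1, RingHom.map_one, one_mul]

/-- Rescaling a hermitian form by a symmetric element. -/
def HermitianForm.rescale {V : Type w} [AddCommGroup V] [Module Qᵐᵒᵖ V] {θ θ' : FInvolution F Q}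
    (u : Q) (hu : θ' u = u) (h : ∀ x, u * θ x = θ' x * u) (f : HermitianForm θ V) :
    HermitianForm θ' V where
  form := ((AddMonoidHom.compHom (AddMonoidHom.mulLeft u)).comp f.form)
  form_smul x y d₁ d₂ := by
    have := h d₁
    simp only [AddMonoidHom.comp_apply, AddMonoidHom.compHom_apply_apply,
      AddMonoidHom.coe_mulLeft, f.form_smul, ← mul_assoc, this]
  form_swap x y := by
    simp only [AddMonoidHom.comp_apply, AddMonoidHom.compHom_apply_apply,
      AddMonoidHom.coe_mulLeft, f.form_swap x y, h, θ'.map_mul, hu]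

theorem uPlus_le_of_rescale {θ θ' : FInvolution F Q} (u : Q) (hu0 : u ≠ 0) (hu : θ' u = u)
    (h : ∀ x, u * θ x = θ' x * u) : uPlus θ ≤ uPlus θ' := by
  refine sSup_le_sSup ?_
  rintro n ⟨V, _, _, hV, f, hf, rfl⟩
  exact ⟨V, _, _, hV, f.rescale u hu h, fun x hx => mul_ne_zero hu0 (hf x hx), rfl⟩

theorem uPlus_eq_uPlus_canonical [CharP F 2] (hQ : IsQuaternionAlgebra F Q)
    (e : ℍ[F,a,1,b] ≃ₐ[F] Q) (θ : FInvolution F Q) :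
    uPlus θ = uPlus (FInvolution.canonical e) := by
  obtain ⟨u, hu0, hu, h⟩ := θ.exists_eq_conj_canonical hQ e
  apply le_antisymm
  · refine uPlus_le_of_rescale u⁻¹ (inv_ne_zero hu0) (by rw [FInvolution.map_inv, hu])
      fun x => ?_
    apply mul_left_cancel₀ hu0
    rw [mul_inv_cancel_left₀ hu0, ← mul_assoc, ← h, mul_inv_cancel_right₀ hu0]
  · refine uPlus_le_of_rescale u hu0 ?_ fun x => (h x).symm
    have := h u
    rw [hu] at this
    exact mul_right_cancel₀ hu0 this

end Canonical

/-! ### Surjectivity of the reduced norm over a Kaplansky field -/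

section Norm

theorem reducedNorm_mul {F : Type u} [Field F] {A : Type v} [Ring A] [Nontrivial A] [Algebra F A]
    {a b : F} (e : ℍ[F,a,1,b] ≃ₐ[F] A) (x y : A) :
    reducedNorm e (x * y) = reducedNorm e x * reducedNorm e y := by
  apply (algebraMap F A).injective
  rw [← canonical_mul_self, FInvolution.map_mul, map_mul, ← canonical_mul_self e y, mul_assoc,
    ← mul_assoc _ x, canonical_mul_self, ← mul_assoc, ← Algebra.commutes, mul_assoc]

theorem reducedNorm_ne_zero {F : Type u} [Field F] {Q : Type v} [DivisionRing Q] [Algebra F Q]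
    {a b : F} (e : ℍ[F,a,1,b] ≃ₐ[F] Q) {x : Q} (hx : x ≠ 0) : reducedNorm e x ≠ 0 := by
  intro h
  have := canonical_mul_self e x
  rw [h, map_zero] at this
  exact mul_ne_zero (FInvolution.map_ne_zero _ hx) hx this

namespace QuaternionAlgebra

variable {F : Type u} [Field F] {a b c : F}

theorem isUnit_of_re_star_mul_self_ne_zero {x : ℍ[F,a,1,c]} (hx : (star x * x).re ≠ 0) :
    IsUnit x := by
  rw [isUnit_iff_exists]
  refine ⟨(star x * x).re⁻¹ • star x, ?_, ?_⟩
  · rw [mul_smul_comm, ← star_comm_self' x, star_mul_eq_coe, smul_coe, re_coe,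
      inv_mul_cancel₀ hx, coe_one]
  · rw [smul_mul_assoc, star_mul_eq_coe, smul_coe, re_coe, inv_mul_cancel₀ hx, coe_one]

variable [CharP F 2]

theorem re_star_mul_self (x : ℍ[F,a,1,c]) :
    (star x * x).re = (x.re ^ 2 + x.re * x.imI + a * x.imI ^ 2)
      + c * (x.imJ ^ 2 + x.imJ * x.imK + a * x.imK ^ 2) := by
  simp [CharTwo.neg_eq, CharTwo.sub_eq_add]
  ring

theorem isQuaternionAlgebra_of_isUnit (h : ∀ x : ℍ[F,a,1,c], IsUnit x ∨ x = 0) :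
    IsQuaternionAlgebra F ℍ[F,a,1,c] where
  isCentral := by
    constructor
    intro x hx
    rw [Subalgebra.mem_center_iff] at hx
    have h1 := hx ⟨0, 1, 0, 0⟩
    have h2 := hx ⟨0, 0, 1, 0⟩
    rw [QuaternionAlgebra.ext_iff] at h1 h2
    simp at h1 h2
    refine Algebra.mem_bot.2 ⟨x.re, ?_⟩
    obtain ⟨h11, h12⟩ := h1
    obtain ⟨h21, h22, h23⟩ := h2
    ext <;> simp <;> grind
  isSimpleRing :=
    letI := DivisionRing.ofIsUnitOrEqZero h
    DivisionRing.isSimpleRing _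
  finrank_eq := finrank_eq_four a 1 c

theorem nonempty_algEquiv_of_isKaplanskyField (hF : IsKaplanskyField F)
    (hb : ∀ x : ℍ[F,a,1,b], IsUnit x ∨ x = 0) (hc : ∀ x : ℍ[F,a,1,c], IsUnit x ∨ x = 0) :
    Nonempty (ℍ[F,a,1,c] ≃ₐ[F] ℍ[F,a,1,b]) := by
  obtain ⟨Q, _, _, -, hQ⟩ := hF
  have h1 : Nonempty (ℍ[F,a,1,c] ≃ₐ[F] Q) :=
    letI := DivisionRing.ofIsUnitOrEqZero hc
    hQ ℍ[F,a,1,c] (isQuaternionAlgebra_of_isUnit hc)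
  have h2 : Nonempty (ℍ[F,a,1,b] ≃ₐ[F] Q) :=
    letI := DivisionRing.ofIsUnitOrEqZero hb
    hQ ℍ[F,a,1,b] (isQuaternionAlgebra_of_isUnit hb)
  exact ⟨h1.some.trans h2.some.symm⟩

/-- The `i`-coordinate of `x²` is the square of the trace `x.imI`, so a scalar square forces trace
zero and `star x = x`. -/
theorem re_star_mul_self_of_mul_self_eq {x : ℍ[F,a,1,b]} (h : x * x = algebraMap F _ c) :
    (star x * x).re = c := by
  have h1 := congrArg imI h
  have h0 : x.imI = 0 := by
    simp [algebraMap_eq, CharTwo.sub_eq_add] at h1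
    grind
  have h2 : star x = x := by ext <;> simp [h0, CharTwo.neg_eq]
  rw [h2, h, algebraMap_eq]

end QuaternionAlgebra

open QuaternionAlgebra

/-- Over a Kaplansky field of characteristic `2`, the reduced norm of the quaternion division
algebra is surjective. -/
theorem IsKaplanskyField.exists_reducedNorm_eq {F : Type u} [Field F] [CharP F 2]
    (hF : IsKaplanskyField F) {Q : Type v} [DivisionRing Q] [Algebra F Q]
    {a b : F} (e : ℍ[F,a,1,b] ≃ₐ[F] Q) (c : F) : ∃ d : Q, reducedNorm e d = c := by
  -- If `ℍ[F,a,1,c]` is a division algebra, it is isomorphic to `Q`, and the image of its third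
  -- basis vector, of square `c`, has norm `c`. Otherwise its norm form has a nontrivial zero, which
  -- exhibits `c` as a quotient of norms from `F(i)`.
  by_cases hdiv : ∀ x : ℍ[F,a,1,c], x ≠ 0 → (star x * x).re ≠ 0
  · have hc (x : ℍ[F,a,1,c]) : IsUnit x ∨ x = 0 := by
      by_cases hx : x = 0
      · exact Or.inr hx
      · exact Or.inl (isUnit_of_re_star_mul_self_ne_zero (hdiv x hx))
    have hb (x : ℍ[F,a,1,b]) : IsUnit x ∨ x = 0 := by
      by_cases hx : x = 0
      · exact Or.inr hx
      · have : e x ≠ 0 := by simpa using hx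
        exact Or.inl (by simpa using (IsUnit.mk0 _ this).map e.symm)
    obtain ⟨f⟩ := nonempty_algEquiv_of_isKaplanskyField hF hb hc
    refine ⟨e (f ⟨0, 0, 1, 0⟩), ?_⟩
    rw [reducedNorm, e.symm_apply_apply]
    apply re_star_mul_self_of_mul_self_eq
    rw [← map_mul, ← f.commutes]
    congr 1
    ext <;> simp [algebraMap_eq]
  · push Not at hdiv
    obtain ⟨x, hx, h⟩ := hdiv
    rw [re_star_mul_self] at h
    have hn (p q : F) : reducedNorm e (e ⟨p, q, 0, 0⟩) = p ^ 2 + p * q + a * q ^ 2 := by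
      rw [reducedNorm, e.symm_apply_apply, re_star_mul_self]
      simp
    have h0 (p q : F) (hpq : p ^ 2 + p * q + a * q ^ 2 = 0) : p = 0 ∧ q = 0 := by
      rw [← hn] at hpq
      have : e ⟨p, q, 0, 0⟩ = 0 := by
        by_contra hne
        exact reducedNorm_ne_zero e hne hpq
      have : (⟨p, q, 0, 0⟩ : ℍ[F,a,1,b]) = 0 := by simpa using this
      rw [QuaternionAlgebra.ext_iff] at this
      exact ⟨this.1, this.2.1⟩
    have hv : x.imJ ^ 2 + x.imJ * x.imK + a * x.imK ^ 2 ≠ 0 := by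
      intro hv
      rw [hv, mul_zero, add_zero] at h
      obtain ⟨h1, h2⟩ := h0 _ _ h
      obtain ⟨h3, h4⟩ := h0 _ _ hv
      exact hx (by ext <;> assumption)
    have hv' : e ⟨x.imJ, x.imK, 0, 0⟩ ≠ 0 := by
      intro h
      rw [← hn, h] at hv
      simp [reducedNorm] at hv
    refine ⟨e ⟨x.re, x.imI, 0, 0⟩ * (e ⟨x.imJ, x.imK, 0, 0⟩)⁻¹, ?_⟩
    apply mul_right_cancel₀ hv
    rw [← hn x.imJ, ← reducedNorm_mul, inv_mul_cancel_right₀ hv', hn, hn]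
    exact CharTwo.add_eq_zero.1 h

end Norm

/-! ### Upper bound: the diagonal modulo scalars -/

section UpperBound

variable {F : Type u} [Field F] {Q : Type v} [DivisionRing Q] [Algebra F Q] {a b : F}

theorem HermitianForm.form_smul_smul_self {θ : FInvolution F Q} {V : Type w} [AddCommGroup V]
    [Module Qᵐᵒᵖ V] (h : HermitianForm θ V) (x : V) (d : Q) :
    h.form (MulOpposite.op d • x) (MulOpposite.op d • x) = θ d * h.form x x * d :=
  h.form_smul x x d d

theorem exists_algebraMap_eq_iff (e : ℍ[F,a,1,b] ≃ₐ[F] Q) {x : Q} : (∃ c, algebraMap F Q c = x) ↔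
    (e.symm x).imI = 0 ∧ (e.symm x).imJ = 0 ∧ (e.symm x).imK = 0 := by
  obtain ⟨x, rfl⟩ := e.surjective x
  rw [e.symm_apply_apply]
  constructor
  · rintro ⟨c, hc⟩
    rw [← e.commutes] at hc
    have hc := e.injective hc
    simp [← hc, QuaternionAlgebra.algebraMap_eq]
  · rintro ⟨h1, h2, h3⟩
    refine ⟨x.re, ?_⟩
    rw [← e.commutes]
    congr 1
    ext <;> simp [QuaternionAlgebra.algebraMap_eq, h1, h2, h3]

variable [CharP F 2] (e : ℍ[F,a,1,b] ≃ₐ[F] Q)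

theorem self_add_canonical (x : Q) :
    x + FInvolution.canonical e x = algebraMap F Q (e.symm x).imI := by
  obtain ⟨x, rfl⟩ := e.surjective x
  rw [FInvolution.canonical_apply, e.symm_apply_apply, ← map_add, ← e.commutes]
  congr 1
  ext <;> simp [QuaternionAlgebra.algebraMap_eq, CharTwo.neg_eq, CharTwo.add_self_eq_zero,
    ← add_assoc]

theorem canonical_eq_self_iff {x : Q} :
    FInvolution.canonical e x = x ↔ (e.symm x).imI = 0 := by
  have : CharP Q 2 := charP_of_injective_algebraMap (algebraMap F Q).injective 2
  rw [eq_comm, ← CharTwo.add_eq_zero, self_add_canonical, map_eq_zero]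

namespace HermitianForm

open MulOpposite

variable {e} {V : Type w} [AddCommGroup V] [Module Qᵐᵒᵖ V]
  (h : HermitianForm (FInvolution.canonical e) V)

/-- The cross terms `h(x,y) + h(y,x)` form a reduced trace, hence a scalar. This is what makes the
diagonal additive modulo `F`. -/
theorem form_self_add (x y : V) : h.form (x + y) (x + y)
    = h.form x x + h.form y y + algebraMap F Q (e.symm (h.form x y)).imI := by
  rw [← self_add_canonical, ← h.form_swap]
  simp only [map_add, AddMonoidHom.add_apply]
  abel

/-- The vectors at which the form takes a value in the base field. -/
def scalarLocus : Submodule Qᵐᵒᵖ V where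
  carrier := {x | ∃ c : F, algebraMap F Q c = h.form x x}
  zero_mem' := ⟨0, by simp⟩
  add_mem' := by
    rintro x y ⟨c, hc⟩ ⟨d, hd⟩
    exact ⟨c + d + (e.symm (h.form x y)).imI, by
      rw [form_self_add, ← hc, ← hd, map_add, map_add]⟩
  smul_mem' := by
    rintro d x ⟨c, hc⟩
    refine ⟨c * reducedNorm e d.unop, ?_⟩
    have := h.form_smul_smul_self x d.unop
    rw [op_unop] at this
    rw [this, ← hc, ← Algebra.commutes, mul_assoc, canonical_mul_self, map_mul]

theorem mem_scalarLocus {x : V} : x ∈ h.scalarLocus ↔ ∃ c : F, algebraMap F Q c = h.form x x :=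
  Iff.rfl

/-- The values of the form on the diagonal, modulo the base field. -/
def diagonalModScalars : V →+ F × F where
  toFun x := ((e.symm (h.form x x)).imJ, (e.symm (h.form x x)).imK)
  map_zero' := by simp
  map_add' x y := by
    rw [form_self_add, map_add, map_add, e.symm.commutes]
    simp [QuaternionAlgebra.algebraMap_eq]

theorem diagonalModScalars_eq_zero_iff {x : V} :
    h.diagonalModScalars x = 0 ↔ x ∈ h.scalarLocus := by
  rw [mem_scalarLocus, exists_algebraMap_eq_iff e, ← canonical_eq_self_iff, ← h.form_swap]
  simp [diagonalModScalars]

theorem diagonalModScalars_smul [Module F V] [IsScalarTower F Qᵐᵒᵖ V] (c : F) (x : V) :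
    h.diagonalModScalars (c • x) = c ^ 2 • h.diagonalModScalars x := by
  have h1 : c • x = op (algebraMap F Q c) • x := (algebraMap_smul Qᵐᵒᵖ c x).symm
  have h2 : e.symm (h.form (c • x) (c • x)) = c ^ 2 • e.symm (h.form x x) := by
    rw [h1, form_smul_smul_self, FInvolution.map_algebraMap, mul_assoc, ← Algebra.commutes c,
      ← mul_assoc, ← map_mul, ← Algebra.smul_def, map_smul, sq]
  simp [diagonalModScalars, h2]

/-- The diagonal modulo scalars has kernel `scalarLocus`, so it is injective on `W`. Being
semilinear along `c ↦ c²`, it compares the `F`-dimension of `W` with the `F²`-dimension of `F × F`.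
-/
theorem finrank_le_of_disjoint_scalarLocus [Module.Finite Qᵐᵒᵖ V] (W : Submodule Qᵐᵒᵖ V)
    (hW : Disjoint W h.scalarLocus) [Module.Finite (frobenius F 2).fieldRange F] :
    4 * Module.finrank Qᵐᵒᵖ W ≤ 2 * Module.finrank (frobenius F 2).fieldRange F := by
  let : Module F V := Module.compHom V (algebraMap F Qᵐᵒᵖ)
  have : IsScalarTower F Qᵐᵒᵖ V := IsScalarTower.of_algebraMap_smul fun _ _ => rfl
  have h4 : Module.finrank F Qᵐᵒᵖ = 4 := by
    rw [← (opLinearEquiv F : Q ≃ₗ[F] Qᵐᵒᵖ).finrank_eq, ← e.toLinearEquiv.finrank_eq,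
      QuaternionAlgebra.finrank_eq_four]
  have hrank := lift_rank_le_of_surjective_injective (R := F) (M := W)
    (R' := (frobenius F 2).fieldRange) (M' := F × F) (frobenius F 2).rangeRestrictField
    (h.diagonalModScalars.comp W.subtype.toAddMonoidHom)
    (by rintro ⟨_, x, rfl⟩; exact ⟨x, rfl⟩)
    (by
      rw [injective_iff_map_eq_zero]
      intro x hx
      have hx : (x : V) ∈ h.scalarLocus := h.diagonalModScalars_eq_zero_iff.1 hx
      exact Subtype.ext (Submodule.disjoint_def.1 hW x x.2 hx))
    (fun c x => h.diagonalModScalars_smul c x)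
  have := Cardinal.toNat_le_toNat hrank
    (Cardinal.lift_lt_aleph0.2 (Module.rank_lt_aleph0 _ _))
  rw [Cardinal.toNat_lift, Cardinal.toNat_lift] at this
  change Module.finrank F W ≤ Module.finrank _ (F × F) at this
  rw [Module.finrank_prod, ← Module.finrank_mul_finrank F Qᵐᵒᵖ W, h4] at this
  omega

/-- Two nonzero orthogonal vectors with scalar values `α`, `β` give an isotropic vector: choose `c`
of norm `α⁻¹β`, so that `α N(c) + β = 2β = 0`. -/
theorem Anisotropic.finrank_scalarLocus_le_one (hF : IsKaplanskyField F) (ha : h.Anisotropic) :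
    Module.finrank Qᵐᵒᵖ h.scalarLocus ≤ 1 := by
  by_cases hW : ∃ x : h.scalarLocus, x ≠ 0
  swap
  · push Not at hW
    exact finrank_le_one 0 fun w => ⟨0, by rw [hW w, smul_zero]⟩
  obtain ⟨x, hx⟩ := hW
  refine finrank_le_one x fun y => ?_
  obtain ⟨α, hα⟩ := x.2
  have hα0 : h.form (x : V) x ≠ 0 := ha x (by simpa using hx)
  -- Gram–Schmidt coefficient: `y - xd` is orthogonal to `x`.
  let d : Q := (h.form (x : V) x)⁻¹ * h.form (x : V) (y : V)
  refine ⟨op d, ?_⟩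
  by_contra hne
  let z : h.scalarLocus := y - op d • x
  have hz : z ≠ 0 := sub_ne_zero.2 (Ne.symm hne)
  have hxz : h.form (x : V) (z : V) = 0 := by
    have h1 : h.form (x : V) (op d • (x : V)) = h.form (x : V) x * d := by
      have := h.form_smul (x : V) x 1 d
      rwa [op_one, one_smul, FInvolution.map_one, one_mul] at this
    simp only [z, Submodule.coe_sub, Submodule.coe_smul, map_sub, h1, d]
    rw [mul_inv_cancel_left₀ hα0, sub_self]
  obtain ⟨β, hβ⟩ := z.2
  obtain ⟨c, hc⟩ := hF.exists_reducedNorm_eq e (α⁻¹ * β)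
  have hα' : α ≠ 0 := by rintro rfl; exact hα0 (by rw [← hα, map_zero])
  have key : h.form (op c • (x : V) + z) (op c • (x : V) + z) = 0 := by
    have h1 : h.form (op c • (x : V)) (z : V) = 0 := by
      have := h.form_smul (x : V) z c 1
      rwa [op_one, one_smul, hxz, mul_zero, zero_mul] at this
    rw [form_self_add, h1, form_smul_smul_self, ← hα, ← hβ, ← Algebra.commutes, mul_assoc,
      canonical_mul_self, hc, ← map_mul, mul_inv_cancel_left₀ hα', ← map_add,
      CharTwo.add_self_eq_zero]
    simp
  refine ha _ ?_ key
  intro h0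
  have h1 : h.form (x : V) (op c • (x : V) + z) = h.form (x : V) x * c := by
    have := h.form_smul (x : V) x 1 c
    rw [op_one, one_smul, FInvolution.map_one, one_mul] at this
    rw [map_add, hxz, add_zero, this]
  rw [h0, map_zero] at h1
  have hc0 : c = 0 := (mul_eq_zero.1 h1.symm).resolve_left hα0
  rw [hc0, op_zero, zero_smul, zero_add] at h0
  exact hz (by simpa using h0)

end HermitianForm

theorem uPlus_canonical_le (hF : IsKaplanskyField F) :
    ((uPlus (FInvolution.canonical e) : ℕ∞) : ENNReal)
      ≤ ((degreeOverSquares F : ℕ∞) : ENNReal) / 2 + 1 := by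
  by_cases hfin : Module.rank (frobenius F 2).fieldRange F < Cardinal.aleph0
  swap
  · have : degreeOverSquares F = ⊤ := Cardinal.toENat_eq_top.2 (not_lt.1 hfin)
    rw [this]
    simp [ENNReal.top_div]
  have : Module.Finite (frobenius F 2).fieldRange F := Module.rank_lt_aleph0_iff.1 hfin
  have hd : degreeOverSquares F = (Module.finrank (frobenius F 2).fieldRange F : ℕ∞) := by
    rw [degreeOverSquares, ← Module.finrank_eq_rank, map_natCast]
  set d := Module.finrank (frobenius F 2).fieldRange F
  -- Rounding `d / 2` down is harmless: the dimension of the complement is an integer.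
  have hle : uPlus (FInvolution.canonical e) ≤ ((d / 2 + 1 : ℕ) : ℕ∞) := by
    apply sSup_le
    rintro n ⟨V, _, _, _, h, ha, rfl⟩
    obtain ⟨W, hW⟩ := h.scalarLocus.exists_isCompl
    have h1 := Submodule.finrank_add_eq_of_isCompl hW
    have h2 := h.finrank_le_of_disjoint_scalarLocus W hW.symm.disjoint
    have h3 := HermitianForm.Anisotropic.finrank_scalarLocus_le_one h hF ha
    have h4 : Module.finrank Qᵐᵒᵖ V ≤ d / 2 + 1 := by omega
    exact_mod_cast h4
  rw [hd]
  calc ((uPlus (FInvolution.canonical e) : ℕ∞) : ENNReal)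
      ≤ (((d / 2 + 1 : ℕ) : ℕ∞) : ENNReal) := by exact_mod_cast hle
    _ = ((d / 2 : ℕ) : ENNReal) + 1 := by push_cast; rfl
    _ ≤ _ := by
        gcongr
        rw [ENat.toENNReal_coe, ENNReal.le_div_iff_mul_le (by simp) (by simp)]
        exact_mod_cast Nat.div_mul_le_self d 2

end UpperBound

/-! ### Lower bound: an explicit anisotropic diagonal form -/

section LowerBound

variable {F : Type u} [Field F] {Q : Type v} [DivisionRing Q] [Algebra F Q] {a b : F}

/-- The diagonal hermitian form with symmetric coefficients `c`. -/
def HermitianForm.diagonal {θ : FInvolution F Q} {ι : Type} [Fintype ι] (c : ι → Q)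
    (hc : ∀ k, θ (c k) = c k) : HermitianForm θ (ι → Q) where
  form := AddMonoidHom.mk' (fun x => AddMonoidHom.mk' (fun y => ∑ k, θ (x k) * c k * y k)
      (fun y y' => by simp [mul_add, Finset.sum_add_distrib]))
    (fun x x' => by ext y; simp [add_mul, Finset.sum_add_distrib])
  form_smul x y d₁ d₂ := by
    simp [FInvolution.map_mul, Finset.mul_sum, Finset.sum_mul, mul_assoc]
  form_swap x y := by
    simp [FInvolution.map_mul, FInvolution.apply_apply, hc, mul_assoc]

theorem HermitianForm.diagonal_form_self {θ : FInvolution F Q} {ι : Type} [Fintype ι] (c : ι → Q)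
    (hc : ∀ k, θ (c k) = c k) (x : ι → Q) :
    (HermitianForm.diagonal c hc).form x x = ∑ k, θ (x k) * c k * x k := rfl

theorem finrank_mulOpposite_pi (ι : Type) [Fintype ι] :
    Module.finrank Qᵐᵒᵖ (ι → Q) = Fintype.card ι := by
  have h : Module.finrank Qᵐᵒᵖ Q = 1 := by
    refine (finrank_eq_one_iff_of_nonzero' (1 : Q) one_ne_zero).2 fun w => ⟨MulOpposite.op w, ?_⟩
    simp
  have : Module.Finite Qᵐᵒᵖ Q := Module.finite_of_finrank_eq_succ h
  rw [Module.finrank_pi_fintype]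
  simp [h]

theorem card_le_uPlus {θ : FInvolution F Q} {ι : Type} [Fintype ι] (c : ι → Q)
    (hc : ∀ k, θ (c k) = c k) (h : (HermitianForm.diagonal c hc).Anisotropic) :
    (Fintype.card ι : ℕ∞) ≤ uPlus θ := by
  have : Module.Finite Qᵐᵒᵖ Q := Module.Finite.of_surjective
    (LinearMap.toSpanSingleton Qᵐᵒᵖ Q 1) fun w => ⟨MulOpposite.op w, by simp⟩
  exact le_sSup ⟨ι → Q, inferInstance, inferInstance, inferInstance, _, h,
    by rw [finrank_mulOpposite_pi]⟩

variable [CharP F 2]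

/-- If `b = s²`, then `s + j` would be a nonzero element of square zero. -/
theorem sq_ne_of_algEquiv (e : ℍ[F,a,1,b] ≃ₐ[F] Q) (s : F) : s ^ 2 ≠ b := by
  intro hs
  let j : ℍ[F,a,1,b] := ⟨s, 0, 1, 0⟩
  have h : j * j = 0 := by
    ext <;> simp [j, ← hs, sq, CharTwo.add_self_eq_zero]
  have h2 : e j * e j = 0 := by rw [← map_mul, h, map_zero]
  have h3 : j = 0 := by simpa using h2
  simpa [j] using congrArg QuaternionAlgebra.imJ h3

/-- The `k`-coordinate sees only `imI` and `imK`; once these vanish, the `j`-coordinate is the same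
form in `re` and `imJ`. -/
theorem star_mul_smul_imK (c : F) (x : ℍ[F,a,1,b]) :
    (star x * (c • (⟨0, 0, 1, 0⟩ : ℍ[F,a,1,b])) * x).imK = c * (x.imI ^ 2 + b * x.imK ^ 2) := by
  simp [CharTwo.neg_eq, CharTwo.sub_eq_add]
  ring_nf
  simp [CharTwo.two_eq_zero]

theorem star_mul_smul_imJ (c : F) (x : ℍ[F,a,1,b]) :
    (star x * (c • (⟨0, 0, 1, 0⟩ : ℍ[F,a,1,b])) * x).imJ
      = c * (x.re ^ 2 + b * x.imJ ^ 2) + (c * x.imI ^ 2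
        + a * (c * (x.imI ^ 2 + b * x.imK ^ 2))) := by
  simp [CharTwo.neg_eq, CharTwo.sub_eq_add]
  ring_nf
  simp [CharTwo.two_eq_zero]

/-- The field generated over the squares by `b` has degree at most `2`. -/
theorem rank_adjoin_le_two (b : F) :
    Module.rank (frobenius F 2).fieldRange
      (IntermediateField.adjoin (frobenius F 2).fieldRange {b}) ≤ 2 := by
  set K := (frobenius F 2).fieldRange
  let p : Polynomial K := Polynomial.X ^ 2 - Polynomial.C ⟨b ^ 2, b, rfl⟩
  have hp : p.Monic := Polynomial.monic_X_pow_sub_C _ two_ne_zero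
  have hb : Polynomial.aeval b p = 0 := by
    simp only [p, map_sub, map_pow, Polynomial.aeval_X, Polynomial.aeval_C]
    exact sub_self (b ^ 2)
  have hint : IsIntegral K b := ⟨p, hp, hb⟩
  have := IntermediateField.adjoin.finiteDimensional hint
  rw [← Module.finrank_eq_rank, IntermediateField.adjoin.finrank hint]
  have h1 := Polynomial.natDegree_le_of_dvd (minpoly.dvd K b hb) hp.ne_zero
  rw [Polynomial.natDegree_X_pow_sub_C] at h1
  exact_mod_cast h1

/-- The coefficients lie in `F²(b)`, so each vanishes by independence; a nonzero `t k` would then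
make `b` the square of `s k / t k`. -/
theorem linearIndependent_coeff_eq_zero (hb : ∀ s : F, s ^ 2 ≠ b) {ι : Type} [Fintype ι]
    {l : ι → F}
    (hl : LinearIndependent (IntermediateField.adjoin (frobenius F 2).fieldRange {b}) l)
    {s t : ι → F} (h : ∑ k, l k * (s k ^ 2 + b * t k ^ 2) = 0) (k : ι) : s k = 0 ∧ t k = 0 := by
  set E := IntermediateField.adjoin (frobenius F 2).fieldRange {b}
  have hsq (x : F) : x ^ 2 ∈ E := E.algebraMap_mem ((frobenius F 2).rangeRestrictField x)
  have hbE : b ∈ E := IntermediateField.mem_adjoin_simple_self _ b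
  let g (k : ι) : E := ⟨s k ^ 2 + b * t k ^ 2, E.add_mem (hsq _) (E.mul_mem hbE (hsq _))⟩
  have hg := Fintype.linearIndependent_iff.1 hl g (by
    rw [← h]
    exact Finset.sum_congr rfl fun k _ => mul_comm _ _) k
  have hg : s k ^ 2 + b * t k ^ 2 = 0 := congrArg Subtype.val hg
  have ht : t k = 0 := by
    by_contra ht
    apply hb (s k / t k)
    rw [div_pow, CharTwo.add_eq_zero.1 hg, mul_div_cancel_right₀ _ (pow_ne_zero 2 ht)]
  rw [ht] at hg
  exact ⟨by simpa using hg, ht⟩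

theorem succ_le_uPlus_canonical (e : ℍ[F,a,1,b] ≃ₐ[F] Q) {n : ℕ} {l : Fin n → F}
    (hl : LinearIndependent (IntermediateField.adjoin (frobenius F 2).fieldRange {b}) l) :
    ((n + 1 : ℕ) : ℕ∞) ≤ uPlus (FInvolution.canonical e) := by
  -- The slot `none`, with coefficient `1`, accounts for the `+ 1`. It contributes a reduced norm,
  -- invisible in the `j`- and `k`-coordinates.
  let c : Option (Fin n) → Q := fun k => k.elim 1 fun k => e (l k • ⟨0, 0, 1, 0⟩)
  have hc (k) : FInvolution.canonical e (c k) = c k := by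
    rw [canonical_eq_self_iff]
    cases k <;> simp [c]
  have hani : (HermitianForm.diagonal c hc).Anisotropic := by
    intro x hx h0
    apply hx
    rw [HermitianForm.diagonal_form_self, Fintype.sum_option] at h0
    let y (k : Fin n) : ℍ[F,a,1,b] := e.symm (x (some k))
    have hsum : algebraMap F _ (reducedNorm e (x none))
        + ∑ k, star (y k) * (l k • (⟨0, 0, 1, 0⟩ : ℍ[F,a,1,b])) * y k = 0 := by
      apply e.injective
      rw [map_zero, ← h0, map_add, e.commutes, map_sum, ← canonical_mul_self]
      simp [c, y, ← FInvolution.canonical_apply]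
    have hJ := congrArg (QuaternionAlgebra.imJₗ a 1 b) hsum
    have hK := congrArg (QuaternionAlgebra.imKₗ a 1 b) hsum
    simp only [map_add, map_sum, map_zero, QuaternionAlgebra.imJₗ, QuaternionAlgebra.imKₗ,
      LinearMap.coe_mk, AddHom.coe_mk, star_mul_smul_imJ, star_mul_smul_imK,
      QuaternionAlgebra.algebraMap_eq, zero_add] at hJ hK
    have hb := sq_ne_of_algEquiv e
    -- The `k`-coordinate kills `imI` and `imK`, then the `j`-coordinate kills `re` and `imJ`; only
    -- the norm of the `none` entry remains.
    have h1 := linearIndependent_coeff_eq_zero hb hl hK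
    simp only [(h1 _).1, (h1 _).2] at hJ
    have h2 := linearIndependent_coeff_eq_zero hb hl (s := fun k => (y k).re)
      (t := fun k => (y k).imJ) (by simpa using hJ)
    have hy (k) : y k = 0 := QuaternionAlgebra.ext (h2 k).1 (h1 k).1 (h2 k).2 (h1 k).2
    simp only [hy, mul_zero, Finset.sum_const_zero, add_zero] at hsum
    have hx0 : x none = 0 := by
      by_contra hne
      exact reducedNorm_ne_zero e hne (by simpa using congrArg QuaternionAlgebra.re hsum)
    ext k
    cases k with
    | none => exact hx0
    | some k => simpa [y] using hy k
  simpa using card_le_uPlus c hc hani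

theorem le_uPlus_canonical (e : ℍ[F,a,1,b] ≃ₐ[F] Q) :
    ((degreeOverSquares F : ℕ∞) : ENNReal) / 2 + 1
      ≤ ((uPlus (FInvolution.canonical e) : ℕ∞) : ENNReal) := by
  set E := IntermediateField.adjoin (frobenius F 2).fieldRange {b}
  have hdeg : degreeOverSquares F ≤ 2 * Cardinal.toENat (Module.rank E F) := by
    rw [degreeOverSquares, ← rank_mul_rank (frobenius F 2).fieldRange E F, map_mul]
    gcongr
    simpa using Cardinal.toENat.monotone' (rank_adjoin_le_two b)
  have hle : Cardinal.toENat (Module.rank E F) + 1 ≤ uPlus (FInvolution.canonical e) := by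
    -- Working with every finite `n` below the rank also covers infinite rank, where `uPlus` exceeds
    -- every natural number.
    have key (n : ℕ) (hn : (n : Cardinal) ≤ Module.rank E F) :
        ((n + 1 : ℕ) : ℕ∞) ≤ uPlus (FInvolution.canonical e) := by
      obtain ⟨l, hl⟩ := Module.le_rank_iff.1 hn
      exact succ_le_uPlus_canonical e hl
    rcases lt_or_ge (Module.rank E F) Cardinal.aleph0 with h | h
    · obtain ⟨n, hn⟩ := Cardinal.lt_aleph0.1 h
      rw [hn, map_natCast]
      exact_mod_cast key n hn.ge
    · have htop : uPlus (FInvolution.canonical e) = ⊤ := by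
        refine ENat.eq_top_iff_forall_ge.2 fun n => le_trans ?_ (key n ?_)
        · exact_mod_cast n.le_succ
        · exact (Cardinal.natCast_lt_aleph0.le).trans h
      rw [htop]
      exact le_top
  calc ((degreeOverSquares F : ℕ∞) : ENNReal) / 2 + 1
      ≤ ((2 * Cardinal.toENat (Module.rank E F) : ℕ∞) : ENNReal) / 2 + 1 := by
        gcongr
    _ = ((Cardinal.toENat (Module.rank E F) + 1 : ℕ∞) : ENNReal) := by
        push_cast
        rw [mul_comm, ENNReal.mul_div_cancel_right (by simp) (by simp)]
    _ ≤ _ := by exact_mod_cast hle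

end LowerBound

theorem mainTheorem10 {F : Type u} [Field F] [CharP F 2] (hF : IsKaplanskyField F)
    {Q : Type v} [DivisionRing Q] [Algebra F Q] (hQ : IsQuaternionAlgebra F Q) :
    Nonempty (FInvolution F Q) ∧
      ∀ θ : FInvolution F Q,
        ((uPlus θ : ℕ∞) : ENNReal) = ((degreeOverSquares F : ℕ∞) : ENNReal) / 2 + 1 := by
  obtain ⟨a, b, ⟨e⟩⟩ := hQ.exists_algEquiv
  refine ⟨⟨FInvolution.canonical e⟩, fun θ => ?_⟩
  rw [uPlus_eq_uPlus_canonical hQ e θ]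
  exact le_antisymm (uPlus_canonical_le e hF) (le_uPlus_canonical e)
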